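/- **Theorem 4.8.** Let $c>0$ be a real number, let $s\in\mathbb{C}$ with $\Re(s)>2$, and let $x\in\mathbb{R}$ with $|x|\le 2c$. Then the three series below converge absolutely, and $$s(s-1)\sum_{n=1}^{\infty}\frac{1}{n^{s+1}}\cos\frac{n\pi x}{c}+\left(\frac{\pi x}{c}\right)^{2}\sum_{n=1}^{\infty}\frac{1}{n^{s-1}}\cos\frac{n\pi x}{c}=\sum_{k=0}^{\infty}(-1)^{k}\,\frac{(s-2k)(s+2k-1)}{(2k)!}\left(\frac{\pi x}{c}\right)^{2k}\zeta(s+1-2k),$$ where $\zeta$ is the Riemann zeta function (continued to $\mathbb{C}\setminus\{1\}$), and where, if $s=2m$ is an even integer, the product $(s-2k)\,\zeta(s+1-2k)$ in the term $k=m$ is understood as its limit $\lim_{w\to 1}(w-1)\zeta(w)=1$. -/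

import Mathlib

/-- The entire function `w ↦ (w - 1) ζ(w)`, whose value at the simple pole `w = 1` of `ζ` is the
limit there, namely the residue `1`. -/
noncomputable def subOneMulZeta : ℂ → ℂ :=
  Function.update (fun w : ℂ => (w - 1) * riemannZeta w) 1 1

/-- The value chosen at `1` is the limit of `(w - 1) ζ(w)`. -/
theorem tendsto_subOneMulZeta_one :
    Filter.Tendsto (fun w : ℂ => (w - 1) * riemannZeta w) (nhdsWithin 1 {1}ᶜ)
      (nhds (subOneMulZeta 1)) := by
  simpa [subOneMulZeta] using riemannZeta_residue_one

/-- Away from `1` the function is the literal product. -/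
theorem subOneMulZeta_of_ne_one {w : ℂ} (hw : w ≠ 1) :
    subOneMulZeta w = (w - 1) * riemannZeta w := by
  simp [subOneMulZeta, hw]

/-- The `k`-th term `(-1)^k (s-2k)(s+2k-1)/(2k)! · θ^(2k) · ζ(s+1-2k)` of the right-hand series.
The factor `(s-2k) ζ(s+1-2k)` is `subOneMulZeta (s+1-2k)`, so that for `s = 2k` it is read
as its limit `1`. -/
noncomputable def zetaSeriesTerm (s : ℂ) (θ : ℝ) (k : ℕ) : ℂ :=
  (-1) ^ k * ((s + 2 * (k : ℂ) - 1) * subOneMulZeta (s + 1 - 2 * (k : ℂ)))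
    / ((2 * k).factorial : ℂ) * (θ : ℂ) ^ (2 * k)

/-- For `s ≠ 2k` the term is literally the displayed expression. -/
theorem zetaSeriesTerm_of_ne {s : ℂ} {k : ℕ} (h : s ≠ 2 * (k : ℂ)) (θ : ℝ) :
    zetaSeriesTerm s θ k =
      (-1) ^ k * ((s - 2 * (k : ℂ)) * (s + 2 * (k : ℂ) - 1)) / ((2 * k).factorial : ℂ)
        * (θ : ℂ) ^ (2 * k) * riemannZeta (s + 1 - 2 * (k : ℂ)) := by
  have h1 : s + 1 - 2 * (k : ℂ) ≠ 1 := fun h2 => h (by linear_combination h2)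
  rw [zetaSeriesTerm, subOneMulZeta_of_ne_one h1]
  ring

/-- The `n`-th term `cos(nπx/c) / n^w` of a cosine series, to be summed over `n ≥ 1`. -/
noncomputable def cosSeriesTerm (w : ℂ) (c x : ℝ) (n : ℕ+) : ℂ :=
  (Real.cos ((n : ℝ) * Real.pi * x / c) : ℂ) / ((n : ℕ) : ℂ) ^ w

/-! Put `θ = πx/c = 2πa`. For `Re s < -2` and `0 < a < 1`, the functional equation turns both cosine
series into even Hurwitz zeta values at `-s` and `2 - s`. Splitting off the `n = 0` summand and
expanding the others binomially in `a` gives a power series with coefficients `ζ(2k - s)`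
(`hasSum_Gamma_mul_riemannZeta`). The left-hand combination is exactly the one in which the
split-off powers of `a` cancel, and the functional equation of `ζ` brings the terms into the stated
form (`hasSum_zetaSeriesTerm_of_re_lt`).

Both sides are entire in `s`, so the identity holds for all `s` when `0 < a < 1`
(`cosZeta_combination_eq_tsum`). For `Re s > 2` both sides are continuous in `a` on `[0, 1]`, which
adds the endpoints; evenness in `x` does the rest. -/

/-! ### Binomial series with Gamma coefficients -/

open Complex in
theorem norm_Gamma_le_Gamma_re {z : ℂ} (hz : 0 < z.re) : ‖Gamma z‖ ≤ Real.Gamma z.re := by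
  rw [Gamma_eq_integral hz, Real.Gamma_eq_integral hz, GammaIntegral]
  refine (MeasureTheory.norm_integral_le_integral_norm _).trans_eq ?_
  refine MeasureTheory.setIntegral_congr_fun measurableSet_Ioi fun t ht => ?_
  have ht : 0 < t := ht
  simp only [norm_mul, norm_real, Real.norm_eq_abs, Real.abs_exp,
    norm_cpow_eq_rpow_re_of_pos ht, sub_re, one_re]

open Complex in
theorem hasSum_Gamma_mul_pow_div_factorial {z t : ℂ} (hz : 0 < z.re) (ht : ‖t‖ < 1) :
    HasSum (fun k : ℕ => Gamma (z + k) / (k.factorial : ℂ) * t ^ k)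
      (Gamma z * (1 / (1 - t) ^ z)) := by
  have h := (one_div_one_sub_cpow_hasFPowerSeriesOnBall_zero z).hasSum (y := t)
    (by
      rw [Metric.mem_eball, edist_zero_right, ← ofReal_norm]
      exact (ENNReal.ofReal_lt_one).mpr ht)
  simp only [zero_add, FormalMultilinearSeries.ofScalars_apply_eq, smul_eq_mul] at h
  refine (h.mul_left (Gamma z)).congr_fun fun k => ?_
  have h1 := Ring.factorial_nsmul_multichoose_eq_ascPochhammer z k
  have hz' : ∀ m : ℕ, z ≠ -m := by
    rintro m rfl
    simp only [neg_re, natCast_re, Left.neg_pos_iff] at hz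
    exact absurd hz (not_lt.mpr m.cast_nonneg)
  rw [Polynomial.ascPochhammer_smeval_eq_eval, ← Gamma_add_nat_div_Gamma_eq z hz',
    Ring.multichoose_eq, nsmul_eq_mul] at h1
  have h2 := Gamma_ne_zero_of_re_pos hz
  have h3 : (k.factorial : ℂ) ≠ 0 := Nat.cast_ne_zero.mpr k.factorial_ne_zero
  field_simp at h1 ⊢
  rw [← h1]

open Complex in
/-- Even part of the binomial series. -/
theorem hasSum_Gamma_mul_pow_two_mul_div_factorial {z t : ℂ} (hz : 0 < z.re) (ht : ‖t‖ < 1) :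
    HasSum (fun k : ℕ => Gamma (z + 2 * k) / ((2 * k).factorial : ℂ) * t ^ (2 * k))
      (Gamma z * ((1 / (1 + t) ^ z + 1 / (1 - t) ^ z) / 2)) := by
  have h := ((hasSum_Gamma_mul_pow_div_factorial hz ht).add
    (hasSum_Gamma_mul_pow_div_factorial (t := -t) hz (by simpa using ht))).div_const 2
  rw [← Function.Injective.hasSum_iff (g := fun k : ℕ => 2 * k) (fun a b h => by simpa using h)]
    at h
  · convert! h using 1
    · ext k
      simp only [Function.comp_apply, Even.neg_pow (even_two_mul k)]
      push_cast
      ring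
    · rw [sub_neg_eq_add]
      ring
  · intro k hk
    have hk : Odd k := by
      rw [← Nat.not_even_iff_odd]
      rintro ⟨m, rfl⟩
      exact hk ⟨m, by simp [two_mul]⟩
    rw [hk.neg_pow]
    ring

/-- At a real parameter the Gamma factors are positive, so these are the norms of the terms of the
even binomial series. This is the majorant for both the double series and the locally uniform bound
in `s`. -/
theorem summable_realGamma_mul_pow_two_mul_div_factorial {x r : ℝ} (hx : 0 < x) (hr : |r| < 1) :
    Summable fun k : ℕ => Real.Gamma (x + 2 * k) / ((2 * k).factorial : ℝ) * |r| ^ (2 * k) := by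
  have h := (hasSum_Gamma_mul_pow_two_mul_div_factorial (z := x) (t := r) (by simpa using hx)
    (by simpa using hr)).summable.norm
  refine h.congr fun k => ?_
  have h1 : ((x : ℂ) + 2 * k) = ((x + 2 * k : ℝ) : ℂ) := by push_cast; rfl
  have h2 : 0 < Real.Gamma (x + 2 * k) := Real.Gamma_pos_of_pos (by positivity)
  rw [h1, Complex.Gamma_ofReal, norm_mul, norm_div, norm_pow, Complex.norm_natCast,
    Complex.norm_real, Complex.norm_real, Real.norm_eq_abs, abs_of_pos h2, Real.norm_eq_abs]

/-! ### The even Hurwitz zeta function as a power series in its parameter -/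

open Complex in
theorem hasSum_hurwitzZetaEven_sub {a : ℝ} (ha0 : 0 < a) (ha1 : a < 1) {z : ℂ} (hz : 1 < z.re) :
    HasSum (fun n : ℕ => (1 / ((n + 1 + a : ℝ) : ℂ) ^ z + 1 / ((n + 1 - a : ℝ) : ℂ) ^ z) / 2)
      (HurwitzZeta.hurwitzZetaEven a z - 1 / (a : ℂ) ^ z / 2) := by
  have h := (hasSum_nat_add_iff' 1).mpr (HurwitzZeta.hasSum_int_hurwitzZetaEven a hz).nat_add_neg
  simp only [Finset.range_one, Finset.sum_singleton, Nat.cast_zero, Int.cast_zero, neg_zero,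
    zero_add, abs_of_pos ha0] at h
  convert! h using 1
  · ext n
    have e1 : |(((n + 1 : ℕ) : ℤ) : ℝ) + a| = n + 1 + a := by
      push_cast
      exact abs_of_pos (by positivity)
    have e2 : |((-((n + 1 : ℕ) : ℤ) : ℤ) : ℝ) + a| = n + 1 - a := by
      push_cast
      rw [abs_of_neg (by have := n.cast_nonneg (α := ℝ); linarith)]
      ring
    rw [e1, e2]
    ring
  · ring

open Complex in
/-- Expansion of the even Hurwitz zeta function in powers of the parameter. -/
theorem hasSum_Gamma_mul_riemannZeta {a : ℝ} (ha0 : 0 < a) (ha1 : a < 1) {z : ℂ}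
    (hz : 1 < z.re) :
    HasSum (fun k : ℕ => Gamma (z + 2 * k) / ((2 * k).factorial : ℂ) * (a : ℂ) ^ (2 * k) *
        riemannZeta (z + 2 * k))
      (Gamma z * (HurwitzZeta.hurwitzZetaEven a z - 1 / (a : ℂ) ^ z / 2)) := by
  have hz0 : 0 < z.re := by linarith
  set F : ℕ × ℕ → ℂ := fun p => Gamma (z + 2 * p.1) / ((2 * p.1).factorial : ℂ) *
    (a : ℂ) ^ (2 * p.1) * (1 / ((p.2 : ℂ) + 1) ^ (z + 2 * p.1)) with hF
  have hna : ∀ n : ℕ, ((n : ℂ) + 1) = ((n + 1 : ℝ) : ℂ) := fun n => by push_cast; rfl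
  have hre : ∀ k : ℕ, (z + 2 * k).re = z.re + 2 * k := fun k => by simp
  have hS : Summable F := by
    have h1 := summable_realGamma_mul_pow_two_mul_div_factorial (r := a) hz0
      (by rwa [abs_of_pos ha0])
    have h2 : Summable fun n : ℕ => 1 / ((n : ℝ) + 1) ^ z.re := by
      have := (summable_nat_add_iff 1).mpr (Real.summable_one_div_nat_rpow.mpr hz)
      simpa using this
    -- Since `n + 1 ≥ 1`, dropping `2k` from the exponent leaves a product majorant.
    refine Summable.of_norm_bounded (h1.mul_of_nonneg h2 ?_ ?_) ?_
    · intro k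
      have : 0 < Real.Gamma (z.re + 2 * k) := Real.Gamma_pos_of_pos (by positivity)
      simp only [Pi.zero_apply]
      positivity
    · intro n
      simp only [Pi.zero_apply]
      positivity
    · rintro ⟨k, n⟩
      have hn : (1 : ℝ) ≤ n + 1 := by simp
      simp only [hF, norm_mul, norm_div, norm_pow, norm_natCast, norm_real, Real.norm_eq_abs,
        norm_one]
      rw [hna, norm_cpow_eq_rpow_re_of_pos (by positivity), hre]
      have hG := norm_Gamma_le_Gamma_re (z := z + 2 * k) (by rw [hre]; positivity)
      rw [hre] at hG
      gcongr
      exact le_add_of_nonneg_right (by positivity)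
  have hk : ∀ k : ℕ, HasSum (fun n => F (k, n)) (Gamma (z + 2 * k) / ((2 * k).factorial : ℂ) *
      (a : ℂ) ^ (2 * k) * riemannZeta (z + 2 * k)) := by
    intro k
    have h1 : 1 < (z + 2 * k).re := by
      rw [hre]
      have := k.cast_nonneg (α := ℝ)
      linarith
    simp only [hF]
    refine HasSum.mul_left _ ?_
    rw [zeta_eq_tsum_one_div_nat_add_one_cpow h1]
    refine Summable.hasSum ?_
    have := (summable_nat_add_iff 1).mpr (Complex.summable_one_div_nat_cpow.mpr h1)
    simpa using this
  have hn : ∀ n : ℕ, HasSum (fun k => F (k, n)) (Gamma z *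
      ((1 / ((n + 1 + a : ℝ) : ℂ) ^ z + 1 / ((n + 1 - a : ℝ) : ℂ) ^ z) / 2)) := by
    intro n
    have hn0 : (0 : ℝ) < n + 1 := by positivity
    have ht1 : a / (n + 1) < 1 := by
      rw [div_lt_one hn0]
      have := n.cast_nonneg (α := ℝ)
      linarith
    have ht0 : 0 < a / (n + 1) := by positivity
    have hne : ((n + 1 : ℝ) : ℂ) ≠ 0 := ofReal_ne_zero.mpr hn0.ne'
    have h := (hasSum_Gamma_mul_pow_two_mul_div_factorial (z := z)
      (t := ((a / (n + 1) : ℝ) : ℂ)) hz0 (by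
        rw [norm_real, Real.norm_eq_abs, abs_of_pos ht0]; exact ht1)).mul_left
        (1 / ((n + 1 : ℝ) : ℂ) ^ z)
    -- Scaling out `n + 1` reduces to the binomial series at `t = a / (n + 1)`.
    have e1 : ((n + 1 + a : ℝ) : ℂ) = ((n + 1 : ℝ) : ℂ) * ((1 + a / (n + 1) : ℝ) : ℂ) := by
      rw [← ofReal_mul]
      congr 1
      field_simp
    have e2 : ((n + 1 - a : ℝ) : ℂ) = ((n + 1 : ℝ) : ℂ) * ((1 - a / (n + 1) : ℝ) : ℂ) := by
      rw [← ofReal_mul]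
      congr 1
      field_simp
    rw [e1, e2, mul_cpow_ofReal_nonneg hn0.le (by positivity),
      mul_cpow_ofReal_nonneg hn0.le (by linarith)]
    convert! h using 1
    · ext k
      simp only [hF]
      rw [hna, cpow_add _ _ hne, ofReal_div, div_pow, show (2 : ℂ) * k = ((2 * k : ℕ) : ℂ) by
        push_cast; rfl, cpow_natCast]
      have : ((n + 1 : ℝ) : ℂ) ^ (2 * k) ≠ 0 := pow_ne_zero _ hne
      field_simp
    · push_cast
      ring
  have hprod := hS.hasSum
  have h2 := ((Equiv.prodComm ℕ ℕ).hasSum_iff.mpr hprod).prod_fiberwise hn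
  rw [← h2.unique ((hasSum_hurwitzZetaEven_sub ha0 ha1 hz).mul_left (Gamma z))]
  exact hprod.prod_fiberwise hk

/-! ### Functional equations and the identity for `Re s < -2` -/

open Complex in
theorem cos_pi_mul_two_mul_nat_sub_div_two (s : ℂ) (k : ℕ) :
    cos (Real.pi * (2 * k - s) / 2) = (-1) ^ k * cos (Real.pi * s / 2) := by
  rw [show (Real.pi : ℂ) * (2 * k - s) / 2 = k * Real.pi - Real.pi * s / 2 by ring,
    cos_antiperiodic.nat_mul_sub_eq, cos_neg]

open Complex in
/-- The functional equation of `ζ` applied to the terms of the series. -/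
theorem zetaSeriesTerm_two_pi_mul {s : ℂ} {k : ℕ} (h : 1 < 2 * k - s.re) (a : ℝ) :
    zetaSeriesTerm s (2 * Real.pi * a) k =
      2 * (2 * Real.pi) ^ s * cos (Real.pi * s / 2) * (((s - 2 * k) * (s + 2 * k - 1)) *
        (Gamma (2 * k - s) / ((2 * k).factorial : ℂ) * (a : ℂ) ^ (2 * k) *
          riemannZeta (2 * k - s))) := by
  have hre : (2 * (k : ℂ) - s).re = 2 * k - s.re := by simp
  have h0 : s ≠ 2 * k := by
    rintro rfl
    simp at h
    linarith
  have h1 : ∀ n : ℕ, 2 * (k : ℂ) - s ≠ -n := by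
    intro n hn
    have := congrArg re hn
    rw [hre] at this
    simp only [neg_re, natCast_re] at this
    have := n.cast_nonneg (α := ℝ)
    linarith
  have h2 : 2 * (k : ℂ) - s ≠ 1 := by
    intro hn
    have := congrArg re hn
    rw [hre, one_re] at this
    linarith
  have hpi : (2 * Real.pi : ℂ) ≠ 0 := by simp [Real.pi_ne_zero]
  rw [zetaSeriesTerm_of_ne h0, show s + 1 - 2 * (k : ℂ) = 1 - (2 * k - s) by ring,
    riemannZeta_one_sub h1 h2, cos_pi_mul_two_mul_nat_sub_div_two,
    show -(2 * (k : ℂ) - s) = s - ((2 * k : ℕ) : ℂ) by push_cast; ring, cpow_sub _ _ hpi,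
    cpow_natCast]
  have h3 : ((-1 : ℂ) ^ k) * (-1) ^ k = 1 := by rw [← mul_pow]; simp
  have h4 : ((2 * k).factorial : ℂ) ≠ 0 := Nat.cast_ne_zero.mpr (Nat.factorial_ne_zero _)
  push_cast
  rw [mul_pow _ (a : ℂ)]
  have h5 : (2 * Real.pi : ℂ) ^ (2 * k) ≠ 0 := pow_ne_zero _ hpi
  generalize cos (Real.pi * s / 2) = c
  field_simp
  linear_combination (s + 2 * k - 1) * (a : ℂ) ^ (2 * k) * Gamma (2 * k - s) *
    c * riemannZeta (2 * k - s) * h3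

open Complex HurwitzZeta in
theorem hasSum_zetaSeriesTerm_of_re_lt {a : ℝ} (ha0 : 0 < a) (ha1 : a < 1) {s : ℂ}
    (hs : s.re < -2) :
    HasSum (zetaSeriesTerm s (2 * Real.pi * a))
      (s * (s - 1) * cosZeta a (s + 1) + (2 * Real.pi * a) ^ 2 * cosZeta a (s - 1)) := by
  have hre : ∀ k : ℕ, 1 < 2 * k - s.re := fun k => by
    have := k.cast_nonneg (α := ℝ)
    linarith
  have hz : 1 < (-s).re := by rw [neg_re]; linarith
  have hz2 : 1 < (2 - s).re := by rw [sub_re, re_ofNat]; linarith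
  have hA := hasSum_Gamma_mul_riemannZeta ha0 ha1 hz
  have hB := (hasSum_Gamma_mul_riemannZeta ha0 ha1 hz2).mul_left ((a : ℂ) ^ 2)
  set A : ℕ → ℂ := fun k => Gamma (-s + 2 * k) / ((2 * k).factorial : ℂ) * (a : ℂ) ^ (2 * k) *
    riemannZeta (-s + 2 * k) with hAdef
  -- The expansion at `2 - s` is the one at `-s` shifted by one index; the factor `2k(2k - 1)`
  -- absorbs the change of factorial and kills `k = 0`.
  have hB' : HasSum (fun k : ℕ => (2 * k * (2 * k - 1) : ℂ) * A k)
      ((a : ℂ) ^ 2 * (Gamma (2 - s) * (hurwitzZetaEven a (2 - s) - 1 / (a : ℂ) ^ (2 - s) / 2))) := by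
    rw [← hasSum_nat_add_iff' 1]
    simp only [Finset.range_one, Finset.sum_singleton, Nat.cast_zero, mul_zero, zero_mul, sub_zero]
    refine hB.congr_fun fun k => ?_
    simp only [hAdef]
    rw [show -s + 2 * ((k + 1 : ℕ) : ℂ) = 2 - s + 2 * k by push_cast; ring,
      show 2 * (k + 1) = 2 * k + 1 + 1 by ring, Nat.factorial_succ, Nat.factorial_succ]
    have h4 : ((2 * k).factorial : ℂ) ≠ 0 := Nat.cast_ne_zero.mpr (Nat.factorial_ne_zero _)
    have h5 : (2 * k + 1 : ℂ) ≠ 0 := by exact_mod_cast (2 * k).succ_ne_zero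
    have h6 : (2 * k + 1 + 1 : ℂ) ≠ 0 := by exact_mod_cast (2 * k + 1).succ_ne_zero
    push_cast
    field_simp
    ring
  have hne : ∀ n : ℕ, -s ≠ -n ∧ -s ≠ 1 - n ∧ 2 - s ≠ 1 - n := by
    intro n
    have hn := n.cast_nonneg (α := ℝ)
    refine ⟨fun h => ?_, fun h => ?_, fun h => ?_⟩ <;>
    · have h := congrArg re h
      simp at h
      linarith
  have hs0 : -s ≠ 0 := by simpa using (hne 0).1
  have hs1 : -s + 1 ≠ 0 := by
    intro h
    exact (hne 2).2.1 (by push_cast; linear_combination h)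
  have hG : Gamma (2 - s) = (-s + 1) * (-s * Gamma (-s)) := by
    rw [← Gamma_add_one _ hs0, ← Gamma_add_one _ hs1]
    congr 1
    ring
  have ha : (a : ℂ) ≠ 0 := ofReal_ne_zero.mpr ha0.ne'
  have hpi : (2 * Real.pi : ℂ) ≠ 0 := by simp [Real.pi_ne_zero]
  -- Uses `(s - 2k)(s + 2k - 1) = s(s - 1) - 2k(2k - 1)`.
  have hC := ((hA.mul_left (s * (s - 1))).sub hB').mul_left
    (2 * (2 * Real.pi) ^ s * cos (Real.pi * s / 2))
  convert! hC using 1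
  · ext k
    rw [zetaSeriesTerm_two_pi_mul (hre k)]
    simp only [hAdef]
    rw [show -s + 2 * (k : ℂ) = 2 * k - s by ring]
    ring
  · have e1 : cosZeta a (s + 1) = 2 * (2 * Real.pi) ^ s * Gamma (-s) * cos (Real.pi * s / 2) *
        hurwitzZetaEven a (-s) := by
      rw [show s + 1 = 1 - (-s) by ring, cosZeta_one_sub _ (fun n => (hne n).2.1), neg_neg,
        show (Real.pi : ℂ) * -s / 2 = -(Real.pi * s / 2) by ring, cos_neg]
    have e2 : cosZeta a (s - 1) = -(2 * ((2 * Real.pi) ^ s / (2 * Real.pi) ^ 2) * Gamma (2 - s) *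
        cos (Real.pi * s / 2) * hurwitzZetaEven a (2 - s)) := by
      have hc := cos_pi_mul_two_mul_nat_sub_div_two s 1
      rw [Nat.cast_one, mul_one] at hc
      rw [show s - 1 = 1 - (2 - s) by ring, cosZeta_one_sub _ (fun n => (hne n).2.2), hc,
        show -(2 - s) = s - ((2 : ℕ) : ℂ) by push_cast; ring, cpow_sub _ _ hpi, cpow_natCast]
      ring
    have e3 : (a : ℂ) ^ (2 - s) = (a : ℂ) ^ 2 * (a : ℂ) ^ (-s) := by
      rw [← cpow_natCast (a : ℂ) 2, ← cpow_add _ _ ha]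
      congr 1
    have h5 : (a : ℂ) ^ (-s) ≠ 0 := by simp [cpow_eq_zero_iff, ha]
    -- The split-off terms cancel because `Γ(2 - s) = s(s - 1) Γ(-s)` and `a² / a^(2 - s) = 1 /
    -- a^(-s)`.
    rw [e1, e2, e3, hG]
    field_simp
    ring

/-! ### Majorants and analytic continuation in `s` -/

open Complex in
theorem differentiable_subOneMulZeta : Differentiable ℂ subOneMulZeta := by
  have h : ∀ w : ℂ, w ≠ 1 → DifferentiableAt ℂ subOneMulZeta w := by
    intro w hw
    have h1 : DifferentiableAt ℂ (fun w : ℂ => (w - 1) * riemannZeta w) w :=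
      (differentiableAt_id.sub_const 1).mul (differentiableAt_riemannZeta hw)
    refine h1.congr_of_eventuallyEq ?_
    filter_upwards [isOpen_ne.mem_nhds hw] with v hv using subOneMulZeta_of_ne_one hv
  intro w
  rcases eq_or_ne w 1 with rfl | hw
  · refine (analyticAt_of_differentiable_on_punctured_nhds_of_continuousAt ?_ ?_).differentiableAt
    · filter_upwards [self_mem_nhdsWithin] with v hv using h v hv
    · rw [continuousAt_iff_punctured_nhds]
      refine tendsto_subOneMulZeta_one.congr' ?_
      filter_upwards [self_mem_nhdsWithin] with v hv using (subOneMulZeta_of_ne_one hv).symm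
  · exact h w hw

theorem differentiable_zetaSeriesTerm (θ : ℝ) (k : ℕ) :
    Differentiable ℂ fun s => zetaSeriesTerm s θ k := by
  have h : Differentiable ℂ fun s : ℂ => subOneMulZeta (s + 1 - 2 * (k : ℂ)) :=
    differentiable_subOneMulZeta.comp (by fun_prop)
  unfold zetaSeriesTerm
  fun_prop

/-- The tail telescopes: with `v k = Γ(k + N + 1 - τ) / (k + N)!`, its terms are `(v k - v (k + 1))
/ τ`, and `v ≥ 0` bounds the partial sums. -/
theorem summable_Gamma_sub_div_factorial {τ : ℝ} (hτ : 0 < τ) :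
    Summable fun k : ℕ => Real.Gamma (k - τ) / (k.factorial : ℝ) := by
  obtain ⟨N, hN⟩ := exists_nat_gt τ
  rw [← summable_nat_add_iff (N + 1)]
  set v : ℕ → ℝ := fun k => Real.Gamma ((k + (N + 1) : ℕ) - τ) / ((k + N).factorial : ℝ) with hv
  have hpos : ∀ k : ℕ, (0 : ℝ) < ((k + (N + 1) : ℕ) : ℝ) - τ := fun k => by
    push_cast
    have := k.cast_nonneg (α := ℝ)
    linarith
  have hf : ∀ k : ℕ, Real.Gamma ((k + (N + 1) : ℕ) - τ) / ((k + (N + 1)).factorial : ℝ) =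
      (v k - v (k + 1)) / τ := by
    intro k
    have e1 : (((k + 1 + (N + 1) : ℕ) : ℝ) - τ) = (((k + (N + 1) : ℕ) : ℝ) - τ) + 1 := by
      push_cast; ring
    simp only [hv]
    rw [e1, Real.Gamma_add_one (hpos k).ne', show k + 1 + N = k + N + 1 by ring,
      show k + (N + 1) = k + N + 1 by ring, Nat.factorial_succ]
    have h4 : ((k + N).factorial : ℝ) ≠ 0 := Nat.cast_ne_zero.mpr (Nat.factorial_ne_zero _)
    have h5 : ((k + N + 1 : ℕ) : ℝ) ≠ 0 := Nat.cast_ne_zero.mpr (Nat.succ_ne_zero _)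
    push_cast at h5 ⊢
    field_simp
    ring
  have hvpos : ∀ k, 0 ≤ v k := fun k =>
    div_nonneg (Real.Gamma_pos_of_pos (hpos k)).le (Nat.cast_nonneg _)
  refine summable_of_sum_range_le (c := v 0 / τ) (fun k =>
    div_nonneg (Real.Gamma_pos_of_pos (hpos k)).le (Nat.cast_nonneg _)) fun n => ?_
  rw [Finset.sum_congr rfl fun k _ => hf k, ← Finset.sum_div, Finset.sum_range_sub']
  gcongr
  linarith [hvpos n]

open Complex in
theorem exists_norm_riemannZeta_le : ∃ Z : ℝ, 0 ≤ Z ∧ ∀ z : ℂ, 2 ≤ z.re → ‖riemannZeta z‖ ≤ Z := by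
  have hS : Summable fun n : ℕ => 1 / ((n : ℝ) + 1) ^ (2 : ℝ) := by
    have := (summable_nat_add_iff 1).mpr
      (Real.summable_one_div_nat_rpow.mpr (by norm_num : (1 : ℝ) < 2))
    simpa using this
  refine ⟨∑' n : ℕ, 1 / ((n : ℝ) + 1) ^ (2 : ℝ), tsum_nonneg fun n => by positivity, fun z hz => ?_⟩
  rw [zeta_eq_tsum_one_div_nat_add_one_cpow (by linarith)]
  refine tsum_of_norm_bounded hS.hasSum fun n => ?_
  rw [show ((n : ℂ) + 1) = ((n + 1 : ℝ) : ℂ) by push_cast; rfl, norm_div, norm_one,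
    norm_cpow_eq_rpow_re_of_pos (by positivity)]
  gcongr
  simp

-- The two linear factors grow like `y = 2k - Re s`, and `y² Γ(y) ≤ Γ(y + 2)` absorbs them. The
-- constant is continuous in `s` and independent of `a`, so the bound serves both for continuation
-- in `s` and for continuity in `a`.
open Complex in
theorem exists_norm_zetaSeriesTerm_le : ∃ C : ℂ → ℝ, Continuous C ∧ (∀ s, 0 ≤ C s) ∧
    ∀ (s : ℂ) (k : ℕ) (a : ℝ), 2 ≤ 2 * k - s.re → ‖zetaSeriesTerm s (2 * Real.pi * a) k‖ ≤
      C s * (Real.Gamma (2 * k + 2 - s.re) / ((2 * k).factorial : ℝ) * |a| ^ (2 * k)) := by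
  obtain ⟨Z, hZ0, hZ⟩ := exists_norm_riemannZeta_le
  have hpi : (2 * Real.pi : ℂ) ≠ 0 := by simp [Real.pi_ne_zero]
  refine ⟨fun s => ‖2 * (2 * Real.pi : ℂ) ^ s * cos (Real.pi * s / 2)‖ * (2 + 3 * ‖s‖) ^ 2 * Z,
    ?_, fun s => by positivity, fun s k a h => ?_⟩
  · have : Continuous fun s : ℂ => (2 * Real.pi : ℂ) ^ s := continuous_id.const_cpow (Or.inl hpi)
    fun_prop
  · rw [zetaSeriesTerm_two_pi_mul (by linarith)]
    have hre : (2 * (k : ℂ) - s).re = 2 * k - s.re := by simp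
    set y : ℝ := 2 * k - s.re with hy
    have hn := norm_nonneg s
    have h1 : ‖s - 2 * k‖ ≤ y * (2 + 3 * ‖s‖) := by
      have e : s - 2 * (k : ℂ) = -(y : ℂ) + (s.im : ℂ) * I := by
        apply Complex.ext <;> simp [hy]
      rw [e]
      refine (norm_add_le _ _).trans ?_
      rw [norm_neg, norm_mul, norm_I, norm_real, norm_real, Real.norm_eq_abs, Real.norm_eq_abs,
        abs_of_nonneg (by linarith : 0 ≤ y)]
      have := abs_im_le_norm s
      nlinarith
    have h2 : ‖s + 2 * k - 1‖ ≤ y * (2 + 3 * ‖s‖) := by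
      have e : s + 2 * (k : ℂ) - 1 = (y : ℂ) + ((s.re : ℂ) + s - 1) := by
        simp only [hy]
        push_cast
        ring
      rw [e]
      refine (norm_add_le _ _).trans ?_
      have h3 : ‖(s.re : ℂ) + s - 1‖ ≤ 2 * ‖s‖ + 1 := by
        refine (norm_sub_le _ _).trans ?_
        have := norm_add_le (s.re : ℂ) s
        have h4 := abs_re_le_norm s
        rw [norm_real, Real.norm_eq_abs] at this
        rw [norm_one]
        linarith
      rw [norm_real, Real.norm_eq_abs, abs_of_nonneg (by linarith : 0 ≤ y)]
      nlinarith
    have hG := norm_Gamma_le_Gamma_re (z := 2 * (k : ℂ) - s) (by rw [hre]; linarith)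
    rw [hre] at hG
    have hz := hZ (2 * (k : ℂ) - s) (by rw [hre]; exact h)
    have hGy : 0 < Real.Gamma y := Real.Gamma_pos_of_pos (by linarith)
    have hG2 : Real.Gamma (2 * k + 2 - s.re) = (y + 1) * (y * Real.Gamma y) := by
      rw [← Real.Gamma_add_one (by linarith), ← Real.Gamma_add_one (by linarith)]
      congr 1
      rw [hy]
      ring
    rw [hG2, norm_mul, norm_mul ((s - 2 * k) * _), norm_mul (s - 2 * k), norm_mul _ (riemannZeta _),
      norm_mul (Gamma _ / _), norm_div, norm_pow, norm_natCast, norm_real, Real.norm_eq_abs]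
    beta_reduce
    have hD := norm_nonneg (2 * (2 * (Real.pi : ℂ)) ^ s * cos (Real.pi * s / 2))
    generalize ‖2 * (2 * (Real.pi : ℂ)) ^ s * cos (Real.pi * s / 2)‖ = D at hD ⊢
    calc _ ≤ D * ((y * (2 + 3 * ‖s‖) * (y * (2 + 3 * ‖s‖))) *
          (Real.Gamma y / ((2 * k).factorial : ℝ) * |a| ^ (2 * k) * Z)) := by gcongr
      _ = D * (2 + 3 * ‖s‖) ^ 2 * Z *
          (y * (y * Real.Gamma y) / ((2 * k).factorial : ℝ) * |a| ^ (2 * k)) := by ring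
      _ ≤ _ := by
        have : 0 ≤ y * Real.Gamma y := by positivity
        gcongr
        linarith

theorem differentiable_tsum_zetaSeriesTerm {a : ℝ} (ha : |a| < 1) :
    (∀ s, Summable (zetaSeriesTerm s (2 * Real.pi * a))) ∧
      Differentiable ℂ fun s => ∑' k : ℕ, zetaSeriesTerm s (2 * Real.pi * a) k := by
  obtain ⟨C, hC, hC0, hT⟩ := exists_norm_zetaSeriesTerm_le
  -- Dropping `M + 1` terms forces `2k - Re s ≥ 2` on the ball, where the norm bound applies and
  -- `Γ`, increasing on `[2, ∞)`, can be made independent of `s`.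
  have key : ∀ M : ℕ, ∃ u : ℕ → ℝ, Summable u ∧ ∀ s ∈ Metric.ball (0 : ℂ) M, ∀ k : ℕ,
      ‖zetaSeriesTerm s (2 * Real.pi * a) (k + (M + 1))‖ ≤ u k := by
    intro M
    obtain ⟨D, hD⟩ := (isCompact_closedBall (0 : ℂ) M).exists_bound_of_continuousOn hC.continuousOn
    have hS := (summable_realGamma_mul_pow_two_mul_div_factorial (x := M + 2) (by positivity) ha)
    refine ⟨_, ((summable_nat_add_iff (M + 1)).mpr hS).mul_left D, fun s hs k => ?_⟩
    have hsM : ‖s‖ < M := by simpa using hs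
    have hre := (abs_le.mp ((Complex.abs_re_le_norm s).trans hsM.le))
    have hk := k.cast_nonneg (α := ℝ)
    have hM := M.cast_nonneg (α := ℝ)
    have hDs : C s ≤ D := (le_abs_self _).trans (hD s (Metric.ball_subset_closedBall hs))
    have h2 : (2 : ℝ) ≤ 2 * (k + (M + 1) : ℕ) - s.re := by
      push_cast
      linarith [hre.2]
    refine (hT s (k + (M + 1)) a h2).trans ?_
    have hG : Real.Gamma (2 * (k + (M + 1) : ℕ) + 2 - s.re) ≤
        Real.Gamma (M + 2 + 2 * (k + (M + 1) : ℕ)) := by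
      refine Real.Gamma_strictMonoOn_Ici.monotoneOn ?_ ?_ ?_
      · simp only [Set.mem_Ici]; linarith
      · simp only [Set.mem_Ici]; push_cast; linarith
      · linarith [hre.1]
    have hG0 : 0 < Real.Gamma (2 * (k + (M + 1) : ℕ) + 2 - s.re) :=
      Real.Gamma_pos_of_pos (by linarith)
    have := (hC0 s).trans hDs
    gcongr
  have hsum : ∀ s, Summable (zetaSeriesTerm s (2 * Real.pi * a)) := by
    intro s
    obtain ⟨M, hM⟩ := exists_nat_gt ‖s‖
    obtain ⟨u, hu, hb⟩ := key M
    rw [← summable_nat_add_iff (M + 1)]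
    exact Summable.of_norm_bounded hu (hb s (by simpa using hM))
  refine ⟨hsum, fun s => ?_⟩
  obtain ⟨M, hM⟩ := exists_nat_gt ‖s‖
  obtain ⟨u, hu, hb⟩ := key M
  have hs : s ∈ Metric.ball (0 : ℂ) M := by simpa using hM
  have h1 := Complex.differentiableOn_tsum_of_summable_norm hu
    (fun k => (differentiable_zetaSeriesTerm (2 * Real.pi * a) (k + (M + 1))).differentiableOn)
    Metric.isOpen_ball (fun k w hw => hb w hw k)
  have h2 := h1.differentiableAt (Metric.isOpen_ball.mem_nhds hs)
  have h3 : DifferentiableAt ℂ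
      (fun s => ∑ k ∈ Finset.range (M + 1), zetaSeriesTerm s (2 * Real.pi * a) k) s :=
    DifferentiableAt.fun_sum fun k _ => differentiable_zetaSeriesTerm _ k s
  refine (h3.add h2).congr_of_eventuallyEq (Filter.Eventually.of_forall fun w => ?_)
  exact ((hsum w).sum_add_tsum_nat_add (M + 1)).symm

open Complex HurwitzZeta in
/-- The expansion for `0 < a < 1` and all complex `s`. -/
theorem cosZeta_combination_eq_tsum {a : ℝ} (ha0 : 0 < a) (ha1 : a < 1) (s : ℂ) :
    s * (s - 1) * cosZeta a (s + 1) + (2 * Real.pi * a) ^ 2 * cosZeta a (s - 1) =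
      ∑' k : ℕ, zetaSeriesTerm s (2 * Real.pi * a) k := by
  -- `cosZeta a` is entire only off the trivial class, so the endpoints need a separate limit.
  have ha : (a : UnitAddCircle) ≠ 0 := by
    rw [Ne, AddCircle.coe_eq_zero_iff_of_mem_Ico ⟨ha0.le, ha1⟩]
    exact ha0.ne'
  have hc := differentiable_cosZeta_of_ne_zero ha
  have hf : Differentiable ℂ fun s : ℂ => s * (s - 1) * cosZeta a (s + 1) +
      (2 * Real.pi * a) ^ 2 * cosZeta a (s - 1) := by
    have h1 : Differentiable ℂ fun s : ℂ => cosZeta a (s + 1) := hc.comp (by fun_prop)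
    have h2 : Differentiable ℂ fun s : ℂ => cosZeta a (s - 1) := hc.comp (by fun_prop)
    fun_prop
  have hg := (differentiable_tsum_zetaSeriesTerm (a := a) (by rwa [abs_of_pos ha0])).2
  refine congrFun (AnalyticOnNhd.eq_of_eventuallyEq
    (hf.differentiableOn.analyticOnNhd isOpen_univ)
    (hg.differentiableOn.analyticOnNhd isOpen_univ) (z₀ := -3) ?_) s
  filter_upwards [(isOpen_lt continuous_re continuous_const).mem_nhds
    (show (-3 : ℂ).re < -2 by norm_num)] with w hw
  exact (hasSum_zetaSeriesTerm_of_re_lt ha0 ha1 hw).tsum_eq.symm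

/-! ### The cosine series and passage to the endpoints -/

theorem norm_cosSeriesTerm_le (w : ℂ) (c x : ℝ) (n : ℕ+) :
    ‖cosSeriesTerm w c x n‖ ≤ 1 / ((n : ℕ) : ℝ) ^ w.re := by
  rw [cosSeriesTerm, norm_div, Complex.norm_real, Complex.norm_natCast_cpow_of_pos n.pos,
    Real.norm_eq_abs]
  gcongr
  exact Real.abs_cos_le_one _

theorem summable_one_div_pnat_rpow {σ : ℝ} (hσ : 1 < σ) :
    Summable fun n : ℕ+ => 1 / ((n : ℕ) : ℝ) ^ σ :=
  summable_pnat_iff_summable_nat (f := fun n : ℕ => 1 / (n : ℝ) ^ σ) |>.mpr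
    (Real.summable_one_div_nat_rpow.mpr hσ)

theorem summable_cosSeriesTerm {w : ℂ} (hw : 1 < w.re) (c x : ℝ) :
    Summable (cosSeriesTerm w c x) :=
  Summable.of_norm_bounded (summable_one_div_pnat_rpow hw) (norm_cosSeriesTerm_le w c x)

open HurwitzZeta in
theorem tsum_cosSeriesTerm_half {w : ℂ} (hw : 1 < w.re) (a : ℝ) :
    ∑' n : ℕ+, cosSeriesTerm w (1 / 2) a n = cosZeta a w := by
  have h := hasSum_nat_cosZeta a hw
  have hw0 : w ≠ 0 := Complex.ne_zero_of_one_lt_re hw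
  -- The `n = 0` term is `1 / 0 ^ w`, which is `0` by convention since `w ≠ 0`.
  rw [← h.tsum_eq, h.summable.tsum_eq_zero_add, ← tsum_pnat_eq_tsum_succ
    (f := fun n : ℕ => (Real.cos (2 * Real.pi * a * n) : ℂ) / (n : ℂ) ^ w), Nat.cast_zero, Nat.cast_zero,
    Complex.zero_cpow hw0, div_zero, zero_add]
  refine tsum_congr fun n => ?_
  rw [cosSeriesTerm]
  congr 3
  ring

theorem continuous_tsum_cosSeriesTerm {w : ℂ} (hw : 1 < w.re) (c : ℝ) :
    Continuous fun x => ∑' n : ℕ+, cosSeriesTerm w c x n := by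
  refine continuous_tsum (fun n => ?_) (summable_one_div_pnat_rpow hw)
    fun n x => norm_cosSeriesTerm_le w c x n
  unfold cosSeriesTerm
  fun_prop

/-- At `a = 1` geometric decay is lost; `Γ(2k + 2 - Re s) / (2k)!` alone is summable because `Re s >
2`, giving a majorant uniform on `[0, 1]`. -/
theorem continuousOn_tsum_zetaSeriesTerm {s : ℂ} (hs : 2 < s.re) :
    (∀ a ∈ Set.Icc (0 : ℝ) 1, Summable (zetaSeriesTerm s (2 * Real.pi * a))) ∧
      ContinuousOn (fun a : ℝ => ∑' k : ℕ, zetaSeriesTerm s (2 * Real.pi * a) k)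
        (Set.Icc 0 1) := by
  obtain ⟨C, -, hC0, hT⟩ := exists_norm_zetaSeriesTerm_le
  obtain ⟨N, hN⟩ := exists_nat_gt s.re
  have hS : Summable fun k : ℕ => C s *
      (Real.Gamma (2 * k + 2 - s.re) / ((2 * k).factorial : ℝ)) := by
    refine Summable.mul_left _ ?_
    refine ((summable_Gamma_sub_div_factorial (τ := s.re - 2) (by linarith)).comp_injective
      (i := fun k : ℕ => 2 * k) fun a b h => by simpa using h).congr fun k => ?_
    simp only [Function.comp_apply]
    congr 2
    push_cast
    ring
  have hb : ∀ a ∈ Set.Icc (0 : ℝ) 1, ∀ k : ℕ,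
      ‖zetaSeriesTerm s (2 * Real.pi * a) (k + (N + 1))‖ ≤ C s *
        (Real.Gamma (2 * (k + (N + 1) : ℕ) + 2 - s.re) /
          ((2 * (k + (N + 1))).factorial : ℝ)) := by
    intro a ha k
    have h2 : (2 : ℝ) ≤ 2 * (k + (N + 1) : ℕ) - s.re := by
      have hk := k.cast_nonneg (α := ℝ)
      push_cast
      linarith
    refine (hT s _ a h2).trans (mul_le_mul_of_nonneg_left (mul_le_of_le_one_right ?_ ?_) (hC0 s))
    · exact div_nonneg (Real.Gamma_pos_of_pos (by linarith)).le (Nat.cast_nonneg _)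
    · rw [abs_of_nonneg ha.1]
      exact pow_le_one₀ ha.1 ha.2
  have hS' := (summable_nat_add_iff (N + 1)).mpr hS
  have hsum : ∀ a ∈ Set.Icc (0 : ℝ) 1, Summable (zetaSeriesTerm s (2 * Real.pi * a)) :=
    fun a ha => (summable_nat_add_iff (N + 1)).mp (Summable.of_norm_bounded hS' (hb a ha))
  have hcont : ∀ k : ℕ, Continuous fun a : ℝ => zetaSeriesTerm s (2 * Real.pi * a) k := by
    intro k
    unfold zetaSeriesTerm
    fun_prop
  refine ⟨hsum, ContinuousOn.congr (f := fun a : ℝ =>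
    ∑ k ∈ Finset.range (N + 1), zetaSeriesTerm s (2 * Real.pi * a) k +
      ∑' k : ℕ, zetaSeriesTerm s (2 * Real.pi * a) (k + (N + 1))) ?_
    fun a ha => ((hsum a ha).sum_add_tsum_nat_add (N + 1)).symm⟩
  exact (continuous_finsetSum _ fun k _ => hcont k).continuousOn.add
    (continuousOn_tsum (fun k => (hcont _).continuousOn) hS' fun k a ha => hb a ha k)

theorem cosSeriesTerm_combination_eq_tsum {s : ℂ} (hs : 2 < s.re) {a : ℝ}
    (ha : a ∈ Set.Icc (0 : ℝ) 1) :
    s * (s - 1) * ∑' n : ℕ+, cosSeriesTerm (s + 1) (1 / 2) a n +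
      (2 * Real.pi * a : ℂ) ^ 2 * ∑' n : ℕ+, cosSeriesTerm (s - 1) (1 / 2) a n =
      ∑' k : ℕ, zetaSeriesTerm s (2 * Real.pi * a) k := by
  have h1 : 1 < (s + 1).re := by rw [Complex.add_re, Complex.one_re]; linarith
  have h2 : 1 < (s - 1).re := by rw [Complex.sub_re, Complex.one_re]; linarith
  have hc1 := continuous_tsum_cosSeriesTerm h1 (1 / 2)
  have hc2 := continuous_tsum_cosSeriesTerm h2 (1 / 2)
  refine Set.EqOn.of_subset_closure (s := Set.Ioo (0 : ℝ) 1) (t := Set.Icc 0 1)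
    (f := fun a : ℝ => s * (s - 1) * ∑' n : ℕ+, cosSeriesTerm (s + 1) (1 / 2) a n +
      (2 * Real.pi * a : ℂ) ^ 2 * ∑' n : ℕ+, cosSeriesTerm (s - 1) (1 / 2) a n) ?_ ?_
    (continuousOn_tsum_zetaSeriesTerm hs).2 Set.Ioo_subset_Icc_self
    (closure_Ioo zero_ne_one).ge ha
  · intro b hb
    simp only [tsum_cosSeriesTerm_half h1, tsum_cosSeriesTerm_half h2]
    exact cosZeta_combination_eq_tsum hb.1 hb.2 s
  · exact Continuous.continuousOn (by fun_prop)

/-! ### Evenness in `x` and the general period -/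

theorem zetaSeriesTerm_congr_abs (s : ℂ) {θ φ : ℝ} (h : |θ| = |φ|) :
    zetaSeriesTerm s θ = zetaSeriesTerm s φ := by
  ext k
  have h2 : (θ : ℂ) ^ 2 = (φ : ℂ) ^ 2 := by exact_mod_cast (sq_eq_sq_iff_abs_eq_abs _ _).mpr h
  simp only [zetaSeriesTerm, pow_mul, h2]

theorem cosSeriesTerm_congr_abs (w : ℂ) {c x d y : ℝ} (h : |x / c| = |y / d|) :
    cosSeriesTerm w c x = cosSeriesTerm w d y := by
  ext n
  rw [cosSeriesTerm, cosSeriesTerm, mul_div_assoc, mul_div_assoc, ← Real.cos_abs, abs_mul, h,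
    ← abs_mul, Real.cos_abs]

theorem theorem4p8 (c : ℝ) (hc : 0 < c) (s : ℂ) (hs : 2 < s.re) (x : ℝ) (hx : |x| ≤ 2 * c) :
    Summable (cosSeriesTerm (s + 1) c x) ∧
    Summable (cosSeriesTerm (s - 1) c x) ∧
    Summable (zetaSeriesTerm s (Real.pi * x / c)) ∧
    s * (s - 1) * ∑' n : ℕ+, cosSeriesTerm (s + 1) c x n
        + ((Real.pi * x / c : ℝ) : ℂ) ^ 2 * ∑' n : ℕ+, cosSeriesTerm (s - 1) c x n
      = ∑' k : ℕ, zetaSeriesTerm s (Real.pi * x / c) k := by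
  have h1 : 1 < (s + 1).re := by rw [Complex.add_re, Complex.one_re]; linarith
  have h2 : 1 < (s - 1).re := by rw [Complex.sub_re, Complex.one_re]; linarith
  -- Chosen so that `2πa = |πx/c|`; then `|x| ≤ 2c` becomes `a ≤ 1`.
  set a : ℝ := |x| / (2 * c) with ha_def
  have ha0 : 0 ≤ a := by positivity
  have ha : a ∈ Set.Icc (0 : ℝ) 1 := ⟨ha0, by rw [ha_def, div_le_one (by positivity)]; exact hx⟩
  have hcos : |x / c| = |a / (1 / 2)| := by
    rw [abs_div, abs_of_pos hc, abs_of_nonneg (a := a / (1 / 2)) (by positivity), ha_def]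
    field_simp
  have hθ : |Real.pi * x / c| = |2 * Real.pi * a| := by
    rw [abs_div, abs_mul, abs_of_pos hc, abs_of_pos Real.pi_pos,
      abs_of_nonneg (a := 2 * Real.pi * a) (by positivity),
      ha_def]
    field_simp
  have hsq : ((Real.pi * x / c : ℝ) : ℂ) ^ 2 = (2 * Real.pi * a : ℂ) ^ 2 := by
    exact_mod_cast congrArg (fun r : ℝ => (r : ℂ)) ((sq_eq_sq_iff_abs_eq_abs _ _).mpr hθ)
  refine ⟨summable_cosSeriesTerm h1 c x, summable_cosSeriesTerm h2 c x, ?_, ?_⟩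
  · rw [zetaSeriesTerm_congr_abs s hθ]
    exact (continuousOn_tsum_zetaSeriesTerm hs).1 a ha
  · rw [zetaSeriesTerm_congr_abs s hθ, cosSeriesTerm_congr_abs _ hcos,
      cosSeriesTerm_congr_abs _ hcos, hsq]
    exact cosSeriesTerm_combination_eq_tsum hs ha
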